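/- For a non-integral real number $\alpha>0$ let $\mathrm{PS}(\alpha)=\{\lfloor n^\alpha\rfloor : n=1,2,3,\ldots\}$. Let $a,b,c$ be positive integers. The equation $ax+by=cz$ is called solvable in $\mathrm{PS}(\alpha)$ if there are infinitely many triples $(x,y,z)\in \mathrm{PS}(\alpha)^3$ with $x,y,z$ pairwise distinct such that $ax+by=cz$. Then for any closed interval $I=[s,t]$ with $2<s<t$, the set of non-integral $\alpha\in I$ such that $ax+by=cz$ is solvable in $\mathrm{PS}(\alpha)$ is uncountable and dense in $I$. -/

import Mathlib

/-- The set `PS(α) = {⌊n ^ α⌋ : n = 1, 2, …}` of terms of the Piatetski-Shapiro sequence with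
exponent `α` (meant for non-integral `α > 0`). -/
def PS (α : ℝ) : Set ℤ :=
  {m | ∃ n : ℕ, 1 ≤ n ∧ m = ⌊(n : ℝ) ^ α⌋}

/-- The equation `a x + b y = c z` is solvable in `A` if infinitely many tuples
`(x, y, z) ∈ A ^ 3` with pairwise distinct entries satisfy it. -/
def LinearEqSolvableIn (a b c : ℕ) (A : Set ℤ) : Prop :=
  {p : ℤ × ℤ × ℤ |
    (p.1 ∈ A ∧ p.2.1 ∈ A ∧ p.2.2 ∈ A) ∧
    (p.1 ≠ p.2.1 ∧ p.1 ≠ p.2.2 ∧ p.2.1 ≠ p.2.2) ∧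
    (a : ℤ) * p.1 + (b : ℤ) * p.2.1 = (c : ℤ) * p.2.2}.Infinite

/-- The set of non-integral `α ∈ I` such that `a x + b y = c z` is solvable in `PS(α)`. -/
def solvableExponents (a b c : ℕ) (I : Set ℝ) : Set ℝ :=
  {α | α ∈ I ∧ (∀ k : ℤ, α ≠ (k : ℝ)) ∧ LinearEqSolvableIn a b c (PS α)}

/-!
For every pair `0 < u < v` and every bound `N`, some exponent in `(u, v)` admits a solution
`x, y, z` in distinct terms with `N ≤ x` which persists under small changes of the exponent
(`exists_mem_robustExponents`). The exponents with such a solution for a given `N` form an open set,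
so by the Baire category theorem almost every positive exponent, in the sense of category, has
infinitely many solutions; a residual subset of `ℝ` meets every open interval in a dense and
uncountable set.

To find the solutions, start from `α` in `(u, v)` and distinct positive integers with
`a n ^ α + b m ^ α = c k ^ α` exactly; the intermediate value theorem gives them
(`exists_nat_rpow_solution`). Multiply the three integers by a large `d`, and replace `α` by the
nearby `β` with `d ^ β = d ^ α + y`. For fixed `y` the difference `β - α` is of order
`d ^ (-α) / log d`, so
`(d n) ^ β = (d ^ α + y) n ^ α + o(1)` as `d → ∞` (`tendsto_mul_rpow_shiftedExponent_sub`), and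
likewise for `m` and `k`: perturbing `α` moves the real point `d ^ α` by any bounded amount `y`, while
the linear relation survives up to `o(1)`.

The linear flow `x ↦ (x n ^ α / c, x m ^ α / c)` on the torus is almost periodic, so finitely many
shifts bring every point of the orbit near `0` (`exists_finite_shifts_near_int`). Moving along the
flow by a further fixed `η > 0` makes `(d n) ^ β` and `(d m) ^ β` exceed multiples `c A` and `c B` of
`c` by amounts strictly between `0` and `1`, and `(d k) ^ β` then exceeds `a A + b B` by such an amount
(`exists_linear_eq_of_near_multiples`). The integer parts `c A`, `c B`, `a A + b B` solve the
equation.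
-/

open Filter Topology

/-! ### Exact solutions in real powers of integers -/

theorem exists_small_rat_rpow_lt {ε u : ℝ} (hε : 0 < ε) (hu : 0 < u) :
    ∃ q : ℚ, 0 < q ∧ q < 1 ∧ (q : ℝ) ^ u < ε := by
  have h : (0 : ℝ) < min 1 (ε ^ u⁻¹) := lt_min one_pos (Real.rpow_pos_of_pos hε _)
  obtain ⟨q, hq0, hq⟩ := exists_rat_btwn h
  have hq0' : (0 : ℝ) < q := hq0
  refine ⟨q, by exact_mod_cast hq0, by exact_mod_cast hq.trans_le (min_le_left _ _), ?_⟩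
  exact (Real.lt_rpow_inv_iff_of_pos hq0'.le hε.le hu).1 (hq.trans_le (min_le_right _ _))

/-- The sign change over `[u, v]` to which the intermediate value theorem is applied. If `a < c`, take
`p > 1` with `a * p ^ x` crossing `c` and `q` tiny; if `c ≤ a`, both `p` and `q` are less than `1` and
the sum decreases in the exponent. -/
theorem exists_rat_rpow_crossing {a b c u v : ℝ} (ha : 0 < a) (hb : 0 < b) (hc : 0 < c)
    (hu : 0 < u) (huv : u < v) :
    ∃ p q : ℚ, 0 < p ∧ 0 < q ∧ p ≠ 1 ∧ q ≠ 1 ∧ p ≠ q ∧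
      ((a * (p : ℝ) ^ u + b * (q : ℝ) ^ u < c ∧ c < a * (p : ℝ) ^ v + b * (q : ℝ) ^ v) ∨
        (a * (p : ℝ) ^ v + b * (q : ℝ) ^ v < c ∧ c < a * (p : ℝ) ^ u + b * (q : ℝ) ^ u)) := by
  have hv : 0 < v := hu.trans huv
  have hinv : v⁻¹ < u⁻¹ := inv_strictAnti₀ hu huv
  rcases lt_or_ge a c with hac | hca
  · have h1 : 1 < c / a := (one_lt_div ha).2 hac
    obtain ⟨p, hp1, hp2⟩ := exists_rat_btwn (Real.rpow_lt_rpow_of_exponent_lt h1 hinv)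
    have hp : (1 : ℝ) < p := (Real.one_lt_rpow h1 (inv_pos.2 hv)).trans hp1
    have hp0 : (0 : ℝ) ≤ p := by linarith
    have hpu : (p : ℝ) ^ u < c / a := (Real.lt_rpow_inv_iff_of_pos hp0 (by positivity) hu).1 hp2
    have hpv : c / a < (p : ℝ) ^ v := (Real.rpow_inv_lt_iff_of_pos (by positivity) hp0 hv).1 hp1
    rw [lt_div_iff₀ ha] at hpu
    rw [div_lt_iff₀ ha] at hpv
    have hε : 0 < (c - a * (p : ℝ) ^ u) / b := div_pos (by linarith) hb
    obtain ⟨q, hq0, hq1, hq⟩ := exists_small_rat_rpow_lt hε hu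
    rw [lt_div_iff₀ hb] at hq
    have hq0' : (0 : ℝ) < q := by exact_mod_cast hq0
    have hp' : 1 < p := by exact_mod_cast hp
    refine ⟨p, q, by linarith, hq0, hp'.ne', hq1.ne, (hq1.trans hp').ne', Or.inl ⟨by linarith, ?_⟩⟩
    have : 0 < b * (q : ℝ) ^ v := by positivity
    linarith
  · -- The bound on `q` makes `c - b * q ^ u` positive and forces `q < p`.
    obtain ⟨q, hq0, hq1, hq⟩ := exists_small_rat_rpow_lt (div_pos hc (add_pos ha hb)) hu
    rw [lt_div_iff₀ (add_pos ha hb)] at hq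
    have hq0' : (0 : ℝ) < q := by exact_mod_cast hq0
    have hq1' : (q : ℝ) < 1 := by exact_mod_cast hq1
    have hqu : 0 < (q : ℝ) ^ u := by positivity
    have hqv : 0 < (q : ℝ) ^ v := by positivity
    have hquv : (q : ℝ) ^ v < (q : ℝ) ^ u := Real.rpow_lt_rpow_of_exponent_gt hq0' hq1' huv
    have hx : (q : ℝ) ^ u < (c - b * (q : ℝ) ^ u) / a := by
      rw [lt_div_iff₀ ha]; linarith
    have hxy : (c - b * (q : ℝ) ^ u) / a < (c - b * (q : ℝ) ^ v) / a := by gcongr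
    have hy : (c - b * (q : ℝ) ^ v) / a < 1 := by
      rw [div_lt_one ha]; nlinarith
    have hx0 := hqu.trans hx
    have hy0 := hx0.trans hxy
    have key : ((c - b * (q : ℝ) ^ u) / a) ^ u⁻¹ < ((c - b * (q : ℝ) ^ v) / a) ^ v⁻¹ :=
      (Real.rpow_lt_rpow hx0.le hxy (inv_pos.2 hu)).trans
        (Real.rpow_lt_rpow_of_exponent_gt hy0 hy hinv)
    obtain ⟨p, hp1, hp2⟩ := exists_rat_btwn key
    have hqp : (q : ℝ) < p := ((Real.lt_rpow_inv_iff_of_pos hq0'.le hx0.le hu).2 hx).trans hp1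
    have hp0 : (0 : ℝ) < p := hq0'.trans hqp
    have hp : (p : ℝ) < 1 := hp2.trans (Real.rpow_lt_one hy0.le hy (inv_pos.2 hv))
    have hpv := (Real.lt_rpow_inv_iff_of_pos hp0.le hy0.le hv).1 hp2
    have hpu := (Real.rpow_inv_lt_iff_of_pos hx0.le hp0.le hu).1 hp1
    rw [lt_div_iff₀ ha] at hpv
    rw [div_lt_iff₀ ha] at hpu
    have hp' : p < 1 := by exact_mod_cast hp
    have hqp' : q < p := by exact_mod_cast hqp
    exact ⟨p, q, by linarith, hq0, hp'.ne, hq1.ne, hqp'.ne', Or.inr ⟨by linarith, by linarith⟩⟩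

/-- Exponents `α` with an exact solution of `a n ^ α + b m ^ α = c k ^ α` in distinct positive
integers are dense in `(0, ∞)`. -/
theorem exists_nat_rpow_solution {a b c u v : ℝ} (ha : 0 < a) (hb : 0 < b) (hc : 0 < c)
    (hu : 0 < u) (huv : u < v) :
    ∃ α ∈ Set.Ioo u v, ∃ n m k : ℕ, 0 < n ∧ 0 < m ∧ 0 < k ∧ n ≠ m ∧ n ≠ k ∧ m ≠ k ∧
      a * (n : ℝ) ^ α + b * (m : ℝ) ^ α = c * (k : ℝ) ^ α := by
  obtain ⟨p, q, hp, hq, hp1, hq1, hpq, h⟩ := exists_rat_rpow_crossing ha hb hc hu huv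
  have hp' : (0 : ℝ) < p := by exact_mod_cast hp
  have hq' : (0 : ℝ) < q := by exact_mod_cast hq
  have hcont : Continuous fun x : ℝ => a * (p : ℝ) ^ x + b * (q : ℝ) ^ x :=
    (continuous_const.mul (Real.continuous_const_rpow hp'.ne')).add
      (continuous_const.mul (Real.continuous_const_rpow hq'.ne'))
  obtain ⟨α, hα, hαc⟩ : ∃ α ∈ Set.Ioo u v, a * (p : ℝ) ^ α + b * (q : ℝ) ^ α = c := by
    rcases h with h | h
    · exact intermediate_value_Ioo huv.le hcont.continuousOn h
    · exact intermediate_value_Ioo' huv.le hcont.continuousOn h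
  obtain ⟨n, hn⟩ := Int.eq_ofNat_of_zero_le (Rat.num_pos.2 hp).le
  obtain ⟨m, hm⟩ := Int.eq_ofNat_of_zero_le (Rat.num_pos.2 hq).le
  have hpn : p = n / p.den := by rw [← Int.cast_natCast, ← hn, Rat.num_div_den]
  have hqm : q = m / q.den := by rw [← Int.cast_natCast, ← hm, Rat.num_div_den]
  have hn0 : 0 < n := by have := Rat.num_pos.2 hp; omega
  have hm0 : 0 < m := by have := Rat.num_pos.2 hq; omega
  have hk : 0 < p.den * q.den := Nat.mul_pos p.den_pos q.den_pos
  have hkQ : ((p.den * q.den : ℕ) : ℚ) ≠ 0 := by exact_mod_cast hk.ne'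
  have hpd : (p.den : ℚ) ≠ 0 := by exact_mod_cast p.den_nz
  have hqd : (q.den : ℚ) ≠ 0 := by exact_mod_cast q.den_nz
  have e1 : ((n * q.den : ℕ) : ℚ) = p * (p.den * q.den : ℕ) := by
    have : (n : ℚ) = p * p.den := (eq_div_iff hpd).1 hpn |>.symm
    push_cast; rw [this, mul_assoc]
  have e2 : ((m * p.den : ℕ) : ℚ) = q * (p.den * q.den : ℕ) := by
    have : (m : ℚ) = q * q.den := (eq_div_iff hqd).1 hqm |>.symm
    push_cast; rw [this]; ring
  have e1' : ((n * q.den : ℕ) : ℝ) = p * (p.den * q.den : ℕ) := by exact_mod_cast e1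
  have e2' : ((m * p.den : ℕ) : ℝ) = q * (p.den * q.den : ℕ) := by exact_mod_cast e2
  refine ⟨α, hα, n * q.den, m * p.den, p.den * q.den, Nat.mul_pos hn0 q.den_pos,
    Nat.mul_pos hm0 p.den_pos, hk, ?_, ?_, ?_, ?_⟩
  · intro h
    have : p * (p.den * q.den : ℕ) = q * (p.den * q.den : ℕ) := by rw [← e1, ← e2, h]
    exact hpq (mul_right_cancel₀ hkQ this)
  · intro h
    rw [h] at e1
    exact hp1 (mul_right_cancel₀ hkQ (by rw [← e1, one_mul]))
  · intro h
    rw [h] at e2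
    exact hq1 (mul_right_cancel₀ hkQ (by rw [← e2, one_mul]))
  · rw [e1', e2', Real.mul_rpow hp'.le (Nat.cast_nonneg _),
      Real.mul_rpow hq'.le (Nat.cast_nonneg _), ← hαc]
    ring

/-! ### Recurrence of a linear flow on the torus -/

/-- Uniform recurrence of the flow `x ↦ (x θ₁, x θ₂)` modulo `1`: the orbit is totally bounded, so
`-x` is close, modulo `1`, to one of finitely many points `s` of the orbit, and then `x + s` is close
to `0`. No independence of `θ₁` and `θ₂` is needed. -/
theorem exists_finite_shifts_near_int (θ₁ θ₂ : ℝ) {ρ : ℝ} (hρ : 0 < ρ) :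
    ∃ T : Set ℝ, T.Finite ∧ ∀ x : ℝ, ∃ s ∈ T, ∃ A B : ℤ,
      |(x + s) * θ₁ - A| < ρ ∧ |(x + s) * θ₂ - B| < ρ := by
  let φ : ℝ → ℝ × ℝ := fun x => (Int.fract (x * θ₁), Int.fract (x * θ₂))
  have hφ : TotallyBounded (Set.range φ) := by
    refine (isCompact_Icc (a := ((0, 0) : ℝ × ℝ)) (b := (1, 1))).totallyBounded.subset ?_
    rintro _ ⟨x, rfl⟩
    exact ⟨⟨Int.fract_nonneg _, Int.fract_nonneg _⟩,
      ⟨(Int.fract_lt_one _).le, (Int.fract_lt_one _).le⟩⟩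
  obtain ⟨S, hS, hfin, hcov⟩ := Metric.finite_approx_of_totallyBounded hφ ρ hρ
  refine ⟨Function.invFun φ '' S, hfin.image _, fun x => ?_⟩
  obtain ⟨y, hyS, hy⟩ := Set.mem_iUnion₂.1 (hcov ⟨-x, rfl⟩)
  have hinv : φ (Function.invFun φ y) = y := Function.invFun_eq (hS hyS)
  refine ⟨_, ⟨y, hyS, rfl⟩, ?_⟩
  generalize Function.invFun φ y = s at hinv
  rw [← hinv, Metric.mem_ball, Prod.dist_eq, max_lt_iff, dist_comm, Real.dist_eq, dist_comm,
    Real.dist_eq] at hy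
  have key (θ : ℝ) : (x + s) * θ - (⌊s * θ⌋ - ⌊-x * θ⌋ : ℤ) =
      Int.fract (s * θ) - Int.fract (-x * θ) := by
    simp only [Int.fract]; push_cast; ring
  exact ⟨_, _, (key θ₁).symm ▸ hy.1, (key θ₂).symm ▸ hy.2⟩

/-! ### Perturbing the exponent -/

/-- The exponent `β` with `d ^ β = d ^ α + y`, meaningful for `1 < d` and `0 < d ^ α + y`. -/
noncomputable def shiftedExponent (α y : ℝ) (d : ℕ) : ℝ :=
  Real.log ((d : ℝ) ^ α + y) / Real.log d

theorem rpow_shiftedExponent {α y : ℝ} {d : ℕ} (hd : 1 < d) (h : 0 < (d : ℝ) ^ α + y) :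
    (d : ℝ) ^ shiftedExponent α y d = (d : ℝ) ^ α + y := by
  have hd' : (1 : ℝ) < d := by exact_mod_cast hd
  rw [Real.rpow_def_of_pos (by linarith), shiftedExponent, mul_div_cancel₀ _ (Real.log_pos hd').ne',
    Real.exp_log h]

theorem tendsto_natCast_rpow_atTop {α : ℝ} (hα : 0 < α) :
    Tendsto (fun d : ℕ => (d : ℝ) ^ α) atTop atTop :=
  (tendsto_rpow_atTop hα).comp tendsto_natCast_atTop_atTop

/-- The factor `1 / log d` in `β - α = log (1 + y / d ^ α) / log d` is what makes this limit `0` rather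
than `y`. -/
theorem tendsto_mul_shiftedExponent_sub {α : ℝ} (hα : 0 < α) (y : ℝ) :
    Tendsto (fun d : ℕ => ((d : ℝ) ^ α + y) * (shiftedExponent α y d - α)) atTop (𝓝 0) := by
  have hx := tendsto_natCast_rpow_atTop hα
  have hlog : Tendsto (fun d : ℕ => Real.log d) atTop atTop :=
    Real.tendsto_log_atTop.comp tendsto_natCast_atTop_atTop
  have h1 := (Real.tendsto_mul_log_one_add_div_atTop y).comp hx
  have h2 : Tendsto (fun d : ℕ => Real.log (1 + y / (d : ℝ) ^ α)) atTop (𝓝 0) := by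
    have h3 : Tendsto (fun d : ℕ => 1 + y / (d : ℝ) ^ α) atTop (𝓝 1) := by
      simpa using tendsto_const_nhds.add (hx.const_div_atTop y)
    simpa [Function.comp_def] using (Real.continuousAt_log one_ne_zero).tendsto.comp h3
  refine ((h1.add (h2.const_mul y)).div_atTop hlog).congr' ?_
  filter_upwards [eventually_gt_atTop 1, hx.eventually_gt_atTop (-y)] with d hd hdy
  have hd' : (1 : ℝ) < d := by exact_mod_cast hd
  have hd0 : (0 : ℝ) < (d : ℝ) ^ α := by positivity
  have hl := Real.log_pos hd'
  have e : 1 + y / (d : ℝ) ^ α = ((d : ℝ) ^ α + y) / (d : ℝ) ^ α := by field_simp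
  simp only [Function.comp_apply, shiftedExponent]
  rw [e, Real.log_div (by linarith) hd0.ne', Real.log_rpow (by linarith)]
  field_simp

theorem tendsto_shiftedExponent {α : ℝ} (hα : 0 < α) (y : ℝ) :
    Tendsto (fun d : ℕ => shiftedExponent α y d) atTop (𝓝 α) := by
  have hx : Tendsto (fun d : ℕ => (d : ℝ) ^ α + y) atTop atTop :=
    tendsto_atTop_add_const_right _ _ (tendsto_natCast_rpow_atTop hα)
  have h : Tendsto (fun d : ℕ => shiftedExponent α y d - α) atTop (𝓝 0) := by
    refine ((tendsto_mul_shiftedExponent_sub hα y).div_atTop hx).congr' ?_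
    filter_upwards [hx.eventually_gt_atTop 0] with d hd
    field_simp
  simpa using h.add_const α

/-- Passing from `α` to the exponent `β` with `d ^ β = d ^ α + y` changes `(d n) ^ α = d ^ α n ^ α`,
up to `o(1)`, only through the shift of `d ^ α` by `y`. -/
theorem tendsto_mul_rpow_shiftedExponent_sub {α : ℝ} (hα : 0 < α) (y : ℝ) {n : ℕ} (hn : 0 < n) :
    Tendsto (fun d : ℕ => ((d * n : ℕ) : ℝ) ^ shiftedExponent α y d -
      ((d : ℝ) ^ α + y) * (n : ℝ) ^ α) atTop (𝓝 0) := by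
  have hn' : (0 : ℝ) < n := by exact_mod_cast hn
  have hO := ((Real.hasStrictDerivAt_const_rpow hn' α).hasDerivAt.isBigO_sub).comp_tendsto
    (tendsto_shiftedExponent hα y)
  have h := ((Asymptotics.isBigO_refl (fun d : ℕ => (d : ℝ) ^ α + y) atTop).mul hO).trans_tendsto
    (tendsto_mul_shiftedExponent_sub hα y)
  refine h.congr' ?_
  filter_upwards [eventually_gt_atTop 1,
    (tendsto_natCast_rpow_atTop hα).eventually_gt_atTop (-y)] with d hd hdy
  simp only [Function.comp_apply]
  rw [Nat.cast_mul, Real.mul_rpow (Nat.cast_nonneg _) hn'.le,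
    rpow_shiftedExponent hd (by linarith)]
  ring

/-! ### Exponents with a stable solution -/

/-- The exponents `α` for which the equation has a solution in distinct terms `X, Y, Z` of `PS α`
with `N ≤ X`, where moreover the powers with integer parts `X, Y, Z` are not integers. The latter
makes the solution persist near `α`, so that the set is open. -/
def robustExponents (a b c : ℕ) (N : ℤ) : Set ℝ :=
  {α | ∃ n m k : ℕ, 0 < n ∧ 0 < m ∧ 0 < k ∧ ∃ X Y Z : ℤ,
    (N ≤ X ∧ X ≠ Y ∧ X ≠ Z ∧ Y ≠ Z ∧ (a : ℤ) * X + b * Y = c * Z) ∧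
    (n : ℝ) ^ α ∈ Set.Ioo (X : ℝ) (X + 1) ∧ (m : ℝ) ^ α ∈ Set.Ioo (Y : ℝ) (Y + 1) ∧
    (k : ℝ) ^ α ∈ Set.Ioo (Z : ℝ) (Z + 1)}

theorem isOpen_robustExponents (a b c : ℕ) (N : ℤ) : IsOpen (robustExponents a b c N) := by
  rw [isOpen_iff_mem_nhds]
  rintro α ⟨n, m, k, hn, hm, hk, X, Y, Z, h, h1, h2, h3⟩
  have hev (j : ℕ) (hj : 0 < j) (W : ℤ) (hW : (j : ℝ) ^ α ∈ Set.Ioo (W : ℝ) (W + 1)) :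
      ∀ᶠ β in 𝓝 α, (j : ℝ) ^ β ∈ Set.Ioo (W : ℝ) (W + 1) :=
    (Real.continuous_const_rpow (Nat.cast_ne_zero.2 hj.ne')).continuousAt.eventually_mem
      (isOpen_Ioo.mem_nhds hW)
  filter_upwards [hev n hn X h1, hev m hm Y h2, hev k hk Z h3] with β h1 h2 h3
  exact ⟨n, m, k, hn, hm, hk, X, Y, Z, h, h1, h2, h3⟩

theorem mem_PS_of_mem_Ioo {α : ℝ} {n : ℕ} (hn : 0 < n) {X : ℤ}
    (h : (n : ℝ) ^ α ∈ Set.Ioo (X : ℝ) (X + 1)) : X ∈ PS α :=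
  ⟨n, hn, (Int.floor_eq_iff.2 ⟨h.1.le, h.2⟩).symm⟩

theorem linearEqSolvableIn_PS_of_forall_mem {a b c : ℕ} {α : ℝ}
    (h : ∀ N : ℕ, α ∈ robustExponents a b c N) : LinearEqSolvableIn a b c (PS α) := by
  refine Set.Infinite.of_image Prod.fst (Set.infinite_of_not_bddAbove ?_)
  rintro ⟨M, hM⟩
  obtain ⟨n, m, k, hn, hm, hk, X, Y, Z, ⟨hNX, hXY, hXZ, hYZ, he⟩, h1, h2, h3⟩ := h (M.toNat + 1)
  have := hM ⟨(X, Y, Z), ⟨⟨mem_PS_of_mem_Ioo hn h1, mem_PS_of_mem_Ioo hm h2,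
    mem_PS_of_mem_Ioo hk h3⟩, ⟨hXY, hXZ, hYZ⟩, he⟩, rfl⟩
  push_cast at hNX
  simp only at this
  omega

/-- Here `x` is a time at which the flow with velocities `θ₁ / c`, `θ₂ / c` is near the lattice, `η` is
the extra time moving the three quantities to the right of the integers, and the `Eᵢ` are errors.
The integers `c A`, `c B`, `a A + b B` in the conclusion satisfy `a X + b Y = c Z`. -/
theorem exists_linear_eq_of_near_multiples {a b c θ₁ θ₂ θ₃ x η ε E₁ E₂ E₃ : ℝ} {A B : ℤ}
    (ha : 0 < a) (hb : 0 < b) (hc : 0 < c)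
    (hθ : a * θ₁ + b * θ₂ = c * θ₃)
    (h₁ : η * θ₁ ∈ Set.Ioo ε (1 - ε)) (h₂ : η * θ₂ ∈ Set.Ioo ε (1 - ε))
    (h₃ : η * θ₃ ∈ Set.Ioo ε (1 - ε))
    (hA : |x * (θ₁ / c) - A| < ε / (2 * (a + b + c)))
    (hB : |x * (θ₂ / c) - B| < ε / (2 * (a + b + c)))
    (hE₁ : |E₁| < ε / 2) (hE₂ : |E₂| < ε / 2) (hE₃ : |E₃| < ε / 2) :
    (x + η) * θ₁ + E₁ ∈ Set.Ioo (c * A) (c * A + 1) ∧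
    (x + η) * θ₂ + E₂ ∈ Set.Ioo (c * B) (c * B + 1) ∧
    (x + η) * θ₃ + E₃ ∈ Set.Ioo (a * A + b * B) (a * A + b * B + 1) := by
  set ρ := ε / (2 * (a + b + c)) with hρ
  have hs : (a + b + c) * ρ = ε / 2 := by rw [hρ]; field_simp
  have hρ0 : 0 < ρ := (abs_nonneg _).trans_lt hA
  have haρ := mul_pos ha hρ0
  have hbρ := mul_pos hb hρ0
  have hcρ := mul_pos hc hρ0
  set e₁ := x * (θ₁ / c) - A with he₁
  set e₂ := x * (θ₂ / c) - B with he₂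
  have x₁ : x * θ₁ = c * A + c * e₁ := by rw [he₁]; field_simp; ring
  have x₂ : x * θ₂ = c * B + c * e₂ := by rw [he₂]; field_simp; ring
  have x₃ : x * θ₃ = a * A + b * B + (a * e₁ + b * e₂) := by
    refine mul_left_cancel₀ hc.ne' ?_
    linear_combination a * x₁ + b * x₂ - x * hθ
  rw [abs_lt] at hA hB hE₁ hE₂ hE₃
  have c1 := mul_lt_mul_of_pos_left hA.1 hc
  have c2 := mul_lt_mul_of_pos_left hA.2 hc
  have c3 := mul_lt_mul_of_pos_left hB.1 hc
  have c4 := mul_lt_mul_of_pos_left hB.2 hc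
  have c5 := mul_lt_mul_of_pos_left hA.1 ha
  have c6 := mul_lt_mul_of_pos_left hA.2 ha
  have c7 := mul_lt_mul_of_pos_left hB.1 hb
  have c8 := mul_lt_mul_of_pos_left hB.2 hb
  obtain ⟨h₁, h₁'⟩ := h₁
  obtain ⟨h₂, h₂'⟩ := h₂
  obtain ⟨h₃, h₃'⟩ := h₃
  simp only [add_mul x η, x₁, x₂, x₃]
  refine ⟨⟨?_, ?_⟩, ⟨?_, ?_⟩, ⟨?_, ?_⟩⟩ <;> linarith

theorem exists_mul_mem_Ioo {θ₁ θ₂ θ₃ : ℝ} (h₁ : 0 < θ₁) (h₂ : 0 < θ₂) (h₃ : 0 < θ₃) :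
    ∃ η ε : ℝ, 0 < ε ∧ ε < 1 ∧ η * θ₁ ∈ Set.Ioo ε (1 - ε) ∧ η * θ₂ ∈ Set.Ioo ε (1 - ε) ∧
      η * θ₃ ∈ Set.Ioo ε (1 - ε) := by
  have hS : 0 < θ₁ + θ₂ + θ₃ := by linarith
  set η := 1 / (θ₁ + θ₂ + θ₃) with hη
  have hη0 : 0 < η := by positivity
  have hsum : η * θ₁ + η * θ₂ + η * θ₃ = 1 := by rw [hη]; field_simp
  have p₁ := mul_pos hη0 h₁
  have p₂ := mul_pos hη0 h₂
  have p₃ := mul_pos hη0 h₃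
  obtain ⟨ε, hε, hε'⟩ := exists_between (lt_min p₁ (lt_min p₂ p₃))
  rw [lt_min_iff, lt_min_iff] at hε'
  refine ⟨η, ε, hε, ?_, ⟨?_, ?_⟩, ⟨?_, ?_⟩, ⟨?_, ?_⟩⟩ <;> linarith

theorem ne_of_mem_Ioo_of_one_lt_abs_sub {r r' : ℝ} {X Y : ℤ} (h : r ∈ Set.Ioo (X : ℝ) (X + 1))
    (h' : r' ∈ Set.Ioo (Y : ℝ) (Y + 1)) (hr : 1 < |r - r'|) : X ≠ Y := by
  rintro rfl
  have : |r - r'| < 1 := abs_lt.2 ⟨by linarith [h.1, h'.2], by linarith [h.2, h'.1]⟩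
  linarith

theorem one_lt_abs_sub_of_near_multiples {z θ θ' E E' : ℝ} (hz : 2 / |θ - θ'| < z) (hθ : θ ≠ θ')
    (hE : |E| < 1 / 2) (hE' : |E'| < 1 / 2) : 1 < |z * θ + E - (z * θ' + E')| := by
  have hp : 0 < |θ - θ'| := abs_pos.2 (sub_ne_zero.2 hθ)
  rw [div_lt_iff₀ hp] at hz
  have hz0 : 2 < |z * (θ - θ')| := by
    rw [abs_mul]; exact hz.trans_le (by gcongr; exact le_abs_self z)
  have e : z * θ + E - (z * θ' + E') = z * (θ - θ') - (E' - E) := by ring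
  have h1 := abs_sub_abs_le_abs_sub (z * (θ - θ')) (E' - E)
  have h2 := abs_sub E' E
  rw [e]; linarith

/-- Exponents with a stable solution beyond any given bound are dense in `(0, ∞)`. -/
theorem exists_mem_robustExponents {a b c : ℕ} (ha : 0 < a) (hb : 0 < b) (hc : 0 < c) (N : ℤ)
    {u v : ℝ} (hu : 0 < u) (huv : u < v) : ∃ β ∈ Set.Ioo u v, β ∈ robustExponents a b c N := by
  have ha' : (0 : ℝ) < a := by exact_mod_cast ha
  have hb' : (0 : ℝ) < b := by exact_mod_cast hb
  have hc' : (0 : ℝ) < c := by exact_mod_cast hc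
  obtain ⟨α, hα, n, m, k, hn, hm, hk, hnm, hnk, hmk, hθ⟩ :=
    exists_nat_rpow_solution ha' hb' hc' hu huv
  have hα0 : 0 < α := hu.trans hα.1
  have hpos {j : ℕ} (hj : 0 < j) : (0 : ℝ) < (j : ℝ) ^ α :=
    Real.rpow_pos_of_pos (Nat.cast_pos.2 hj) _
  have hne {i j : ℕ} (hij : i ≠ j) : (i : ℝ) ^ α ≠ (j : ℝ) ^ α := fun h =>
    hij (by exact_mod_cast (Real.rpow_left_inj (Nat.cast_nonneg i) (Nat.cast_nonneg j) hα0.ne').1 h)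
  obtain ⟨η, ε, hε, hε1, h₁, h₂, h₃⟩ := exists_mul_mem_Ioo (hpos hn) (hpos hm) (hpos hk)
  obtain ⟨T, hT, hrec⟩ := exists_finite_shifts_near_int ((n : ℝ) ^ α / c) ((m : ℝ) ^ α / c)
    (ρ := ε / (2 * (a + b + c))) (by positivity)
  have hE (s : ℝ) {j : ℕ} (hj : 0 < j) : ∀ᶠ d : ℕ in atTop,
      |((d * j : ℕ) : ℝ) ^ shiftedExponent α (s + η) d - ((d : ℝ) ^ α + (s + η)) * (j : ℝ) ^ α|
        < ε / 2 := by
    simpa using (tendsto_mul_rpow_shiftedExponent_sub hα0 (s + η) hj).abs.eventually_lt_const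
      (by simpa using half_pos hε)
  have hz (s M : ℝ) : ∀ᶠ d : ℕ in atTop, M < (d : ℝ) ^ α + (s + η) :=
    (tendsto_atTop_add_const_right _ _ (tendsto_natCast_rpow_atTop hα0)).eventually_gt_atTop M
  -- The set `T` of shifts is finite, so one `d` serves all of them; the shift `s` to be used depends
  -- on `d` and is chosen only afterwards.
  have hd : ∀ᶠ d : ℕ in atTop, 0 < d ∧ ∀ s ∈ T,
      shiftedExponent α (s + η) d ∈ Set.Ioo u v ∧
      |((d * n : ℕ) : ℝ) ^ shiftedExponent α (s + η) d - ((d : ℝ) ^ α + (s + η)) * (n : ℝ) ^ α|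
        < ε / 2 ∧
      |((d * m : ℕ) : ℝ) ^ shiftedExponent α (s + η) d - ((d : ℝ) ^ α + (s + η)) * (m : ℝ) ^ α|
        < ε / 2 ∧
      |((d * k : ℕ) : ℝ) ^ shiftedExponent α (s + η) d - ((d : ℝ) ^ α + (s + η)) * (k : ℝ) ^ α|
        < ε / 2 ∧
      2 / |(n : ℝ) ^ α - (m : ℝ) ^ α| < (d : ℝ) ^ α + (s + η) ∧
      2 / |(n : ℝ) ^ α - (k : ℝ) ^ α| < (d : ℝ) ^ α + (s + η) ∧
      2 / |(m : ℝ) ^ α - (k : ℝ) ^ α| < (d : ℝ) ^ α + (s + η) ∧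
      (N + 2) / (n : ℝ) ^ α < (d : ℝ) ^ α + (s + η) := by
    refine (eventually_gt_atTop 0).and ((hT.eventually_all).2 fun s _ => ?_)
    exact ((tendsto_shiftedExponent hα0 (s + η)).eventually_mem (isOpen_Ioo.mem_nhds hα)).and
      ((hE s hn).and ((hE s hm).and ((hE s hk).and
        ((hz s _).and ((hz s _).and ((hz s _).and (hz s _)))))))
  obtain ⟨d, hd0, hd⟩ := hd.exists
  obtain ⟨s, hs, A, B, hA, hB⟩ := hrec ((d : ℝ) ^ α)
  obtain ⟨hβ, E₁, E₂, E₃, d₁, d₂, d₃, hN⟩ := hd s hs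
  obtain ⟨i₁, i₂, i₃⟩ := exists_linear_eq_of_near_multiples ha' hb' hc' hθ h₁ h₂ h₃ hA hB E₁ E₂ E₃
  have g₁ := one_lt_abs_sub_of_near_multiples d₁ (hne hnm) (E₁.trans (by linarith))
    (E₂.trans (by linarith))
  have g₂ := one_lt_abs_sub_of_near_multiples d₂ (hne hnk) (E₁.trans (by linarith))
    (E₃.trans (by linarith))
  have g₃ := one_lt_abs_sub_of_near_multiples d₃ (hne hmk) (E₂.trans (by linarith))
    (E₃.trans (by linarith))
  rw [add_assoc ((d : ℝ) ^ α), add_sub_cancel] at i₁ i₂ i₃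
  rw [add_sub_cancel, add_sub_cancel] at g₁ g₂ g₃
  have i₁' : ((d * n : ℕ) : ℝ) ^ shiftedExponent α (s + η) d ∈
      Set.Ioo ((c * A : ℤ) : ℝ) ((c * A : ℤ) + 1) := by push_cast at i₁ ⊢; exact i₁
  have i₂' : ((d * m : ℕ) : ℝ) ^ shiftedExponent α (s + η) d ∈
      Set.Ioo ((c * B : ℤ) : ℝ) ((c * B : ℤ) + 1) := by push_cast at i₂ ⊢; exact i₂
  have i₃' : ((d * k : ℕ) : ℝ) ^ shiftedExponent α (s + η) d ∈
      Set.Ioo ((a * A + b * B : ℤ) : ℝ) ((a * A + b * B : ℤ) + 1) := by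
    push_cast at i₃ ⊢; exact i₃
  refine ⟨_, hβ, d * n, d * m, d * k, Nat.mul_pos hd0 hn, Nat.mul_pos hd0 hm, Nat.mul_pos hd0 hk,
    c * A, c * B, a * A + b * B, ⟨?_, ne_of_mem_Ioo_of_one_lt_abs_sub i₁' i₂' g₁,
      ne_of_mem_Ioo_of_one_lt_abs_sub i₁' i₃' g₂, ne_of_mem_Ioo_of_one_lt_abs_sub i₂' i₃' g₃,
      by ring⟩, i₁', i₂', i₃'⟩
  rw [div_lt_iff₀ (hpos hn)] at hN
  have h := i₁'.2
  have h' := (abs_lt.1 E₁).1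
  have : (N : ℝ) < (c * A : ℤ) := by linarith
  exact (Int.cast_lt.1 this).le

/-! ### Category argument -/

/-- The negative half-line is added only to have a dense open subset of the whole of `ℝ`. -/
theorem dense_robustExponents_union_Iio {a b c : ℕ} (ha : 0 < a) (hb : 0 < b) (hc : 0 < c)
    (N : ℤ) : Dense (robustExponents a b c N ∪ Set.Iio 0) := by
  refine dense_of_exists_between fun x y hxy => ?_
  rcases lt_or_ge x 0 with hx | hx
  · obtain ⟨z, hz, hz'⟩ := exists_between (lt_min hxy hx)
    exact ⟨z, Or.inr (hz'.trans_le (min_le_right _ _)), hz, hz'.trans_le (min_le_left _ _)⟩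
  · obtain ⟨w, hw, hw'⟩ := exists_between hxy
    obtain ⟨β, hβ, h⟩ := exists_mem_robustExponents ha hb hc N (hx.trans_lt hw) hw'
    exact ⟨β, Or.inl h, hw.trans hβ.1, hβ.2⟩

theorem eventually_residual_linearEqSolvableIn {a b c : ℕ} (ha : 0 < a) (hb : 0 < b) (hc : 0 < c) :
    ∀ᶠ α in residual ℝ, 0 ≤ α → LinearEqSolvableIn a b c (PS α) := by
  have h : ∀ᶠ α in residual ℝ, ∀ N : ℕ, α ∈ robustExponents a b c N ∪ Set.Iio 0 :=
    eventually_countable_forall.2 fun N => residual_of_dense_open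
      ((isOpen_robustExponents a b c N).union isOpen_Iio)
      (dense_robustExponents_union_Iio ha hb hc N)
  filter_upwards [h] with α hα hα0
  exact linearEqSolvableIn_PS_of_forall_mem fun N => (hα N).resolve_right (not_lt.2 hα0)

theorem compl_mem_residual_of_countable {C : Set ℝ} (hC : C.Countable) : Cᶜ ∈ residual ℝ :=
  residual_of_dense_Gδ hC.isGδ_compl (hC.dense_compl ℝ)

theorem corollary2 (a b c : ℕ) (ha : 0 < a) (hb : 0 < b) (hc : 0 < c)
    (s t : ℝ) (hs : 2 < s) (hst : s < t) :
    ¬ (solvableExponents a b c (Set.Icc s t)).Countable ∧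
      Set.Icc s t ⊆ closure (solvableExponents a b c (Set.Icc s t)) := by
  have hR : {α : ℝ | (0 ≤ α → LinearEqSolvableIn a b c (PS α)) ∧ ∀ k : ℤ, α ≠ k} ∈ residual ℝ := by
    filter_upwards [eventually_residual_linearEqSolvableIn ha hb hc,
      compl_mem_residual_of_countable (Set.countable_range ((↑) : ℤ → ℝ))] with α h1 h2
    exact ⟨h1, fun k hk => h2 ⟨k, hk.symm⟩⟩
  have hsub : Set.Ioo s t ∩ {α : ℝ | (0 ≤ α → LinearEqSolvableIn a b c (PS α)) ∧ ∀ k : ℤ, α ≠ k} ⊆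
      solvableExponents a b c (Set.Icc s t) := fun α ⟨hα, h1, h2⟩ =>
    ⟨Set.Ioo_subset_Icc_self hα, h2, h1 (by linarith [hα.1])⟩
  constructor
  · intro hC
    obtain ⟨α, hα, h1, h2⟩ := (dense_of_mem_residual
      (Filter.inter_mem hR (compl_mem_residual_of_countable hC))).inter_open_nonempty _ isOpen_Ioo
        (Set.nonempty_Ioo.2 hst)
    exact h2 (hsub ⟨hα, h1⟩)
  · exact (closure_Ioo hst.ne).superset.trans <|
      closure_minimal (((dense_of_mem_residual hR).open_subset_closure_inter isOpen_Ioo).trans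
        (closure_mono hsub)) isClosed_closure
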